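/- Let $U\in\mathbb{R}^{n\times n}$ ($n\ge 1$) be the matrix with $U(i,i)=0$; $U(i,j)=2$ if $i=j+1$ and $U(i,j)=1$ if $i>j+1$; $U(i,j)=-2$ if $j=i+1$ and $U(i,j)=-1$ if $j>i+1$. It is regarded as a zero-sum game in which the row player minimizes and the column player maximizes $p^\top U q$ over mixed strategies $p,q\in\Delta_n$. Stochastic Double Oracle (SDO), given $0\le\varepsilon<1$ and initial pure strategies $k,l\in[n]$, starts with $R=\{k\}$, $C=\{l\}$, $p=e_k$, $q=e_l$. While $\max_j (p^\top U)_j-\min_i (Uq)_i>\varepsilon$, it performs an iteration: it replaces $(p,q)$ by a Nash equilibrium $\mathrm{getNash}(U[R,C])$ of the subgame with rows $R$ and columns $C$ (extended by zeros), where $\mathrm{getNash}$ is an arbitrary fixed function returning an equilibrium of each such subgame; then it adds to $R$ an index in $\arg\min_i (Uq-u)_i$ and to $C$ an index in $\arg\max_j (p^\top U+v)_j$ (with any fixed measurable tie-breaking rules). Here $u,v\in\mathbb{R}^n$ are drawn afresh in every iteration, and all their entries, over all iterations, are independent and uniformly distributed on $[-1,1]$. When the loop ends, SDO returns $(p,q)$.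 **Theorem.** There is an absolute constant $K$ such that for all $n\ge1$, all $k,l\in[n]$, all $0\le\varepsilon<1$, and all choices of $\mathrm{getNash}$ and of the tie-breaking rules, the expected number of iterations of SDO on $U$ is at most $K\ln n$. Moreover, $U$ has exactly one Nash equilibrium, namely $(e_1,e_1)$, and SDO almost surely terminates and returns it. In other words, SDO with uniform perturbations finds the Nash equilibrium of $U$ in $O(\log n)$ expected iterations. -/

import Mathlib

open MeasureTheory ProbabilityTheory
open scoped Matrix ENNReal

noncomputable section

namespace MatrixGame

variable {ι κ : Type*} [Fintype ι] [Fintype κ]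

/-- Expected outcome `pᵀ M q`; the row player minimizes it, the column player maximizes it. -/
def outcome (M : Matrix ι κ ℝ) (p : ι → ℝ) (q : κ → ℝ) : ℝ := p ⬝ᵥ (M *ᵥ q)

/-- Best-response value of the row player against `q`: `min_i (M q)_i`. -/
def brValRow (M : Matrix ι κ ℝ) (q : κ → ℝ) : ℝ := ⨅ i, (M *ᵥ q) i

/-- Best-response value of the column player against `p`: `max_j (pᵀ M)_j`. -/
def brValCol (M : Matrix ι κ ℝ) (p : ι → ℝ) : ℝ := ⨆ j, (p ᵥ* M) j

/-- `(p, q)` is an `ε`-Nash equilibrium of the matrix game `M`. -/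
def IsEpsNash (ε : ℝ) (M : Matrix ι κ ℝ) (p : ι → ℝ) (q : κ → ℝ) : Prop :=
  p ∈ stdSimplex ℝ ι ∧ q ∈ stdSimplex ℝ κ ∧
    outcome M p q - brValRow M q ≤ ε ∧ brValCol M p - outcome M p q ≤ ε

/-- Nash equilibrium. -/
def IsNash (M : Matrix ι κ ℝ) (p : ι → ℝ) (q : κ → ℝ) : Prop := IsEpsNash 0 M p q

/-- `(p, q)` is a Nash equilibrium of the subgame of `M` with rows `R` and columns `C`, where
the strategies of the subgame are extended by zero to all rows and columns of `M`. -/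
def IsSubgameNash (M : Matrix ι κ ℝ) (R : Finset ι) (C : Finset κ)
    (p : ι → ℝ) (q : κ → ℝ) : Prop :=
  (∀ i, i ∉ R → p i = 0) ∧ (∀ j, j ∉ C → q j = 0) ∧
    IsNash (M.submatrix (fun i : R => (i : ι)) (fun j : C => (j : κ)))
      (fun i : R => p i) (fun j : C => q j)

/-- `f` selects, in a measurable way, an index of a minimal entry of every vector. -/
def IsArgminSelector {n : ℕ} (f : (Fin n → ℝ) → Fin n) : Prop :=
  Measurable f ∧ ∀ (x : Fin n → ℝ) (i : Fin n), x (f x) ≤ x i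

/-- `f` selects, in a measurable way, an index of a maximal entry of every vector. -/
def IsArgmaxSelector {n : ℕ} (f : (Fin n → ℝ) → Fin n) : Prop :=
  Measurable f ∧ ∀ (x : Fin n → ℝ) (i : Fin n), x i ≤ x (f x)

/-- The variables of Stochastic Double Oracle: the sets `R`, `C` of available pure strategies,
and the current pair `(p, q)` of mixed strategies. -/
structure SDOState (m n : ℕ) where
  R : Finset (Fin m)
  C : Finset (Fin n)
  p : Fin m → ℝ
  q : Fin n → ℝ

variable {m n : ℕ}

/-- Initialization with the pure strategies `k`, `l`. -/
def sdoInit (k : Fin m) (l : Fin n) : SDOState m n where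
  R := {k}
  C := {l}
  p := Pi.single k 1
  q := Pi.single l 1

/-- One pass through the loop of Stochastic Double Oracle, with perturbation vectors `u`, `v`:
solve the current subgame, then add a perturbed best response for either player. -/
def sdoStep (M : Matrix (Fin m) (Fin n) ℝ)
    (getNash : Finset (Fin m) → Finset (Fin n) → (Fin m → ℝ) × (Fin n → ℝ))
    (argminSel : (Fin m → ℝ) → Fin m) (argmaxSel : (Fin n → ℝ) → Fin n)
    (u : Fin m → ℝ) (v : Fin n → ℝ) (s : SDOState m n) : SDOState m n where
  R := insert (argminSel (M *ᵥ (getNash s.R s.C).2 - u)) s.R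
  C := insert (argmaxSel ((getNash s.R s.C).1 ᵥ* M + v)) s.C
  p := (getNash s.R s.C).1
  q := (getNash s.R s.C).2

/-- The state after `t` passes, if the loop is never left; pass number `t` (counted from zero)
uses the perturbations `u t`, `v t`. -/
def sdoState (M : Matrix (Fin m) (Fin n) ℝ)
    (getNash : Finset (Fin m) → Finset (Fin n) → (Fin m → ℝ) × (Fin n → ℝ))
    (argminSel : (Fin m → ℝ) → Fin m) (argmaxSel : (Fin n → ℝ) → Fin n)
    (k : Fin m) (l : Fin n) (u : ℕ → Fin m → ℝ) (v : ℕ → Fin n → ℝ) : ℕ → SDOState m n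
  | 0 => sdoInit k l
  | t + 1 => sdoStep M getNash argminSel argmaxSel (u t) (v t)
      (sdoState M getNash argminSel argmaxSel k l u v t)

/-- The termination condition `ub - lb ≤ ε`. -/
def sdoStops (M : Matrix (Fin m) (Fin n) ℝ) (ε : ℝ) (s : SDOState m n) : Prop :=
  brValCol M s.p - brValRow M s.q ≤ ε

/-- The number of passes through the loop until the termination condition holds
(`⊤` if it never does). -/
def sdoIterations (M : Matrix (Fin m) (Fin n) ℝ) (ε : ℝ)
    (getNash : Finset (Fin m) → Finset (Fin n) → (Fin m → ℝ) × (Fin n → ℝ))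
    (argminSel : (Fin m → ℝ) → Fin m) (argmaxSel : (Fin n → ℝ) → Fin n)
    (k : Fin m) (l : Fin n) (u : ℕ → Fin m → ℝ) (v : ℕ → Fin n → ℝ) : ℕ∞ :=
  ⨅ (t : ℕ) (_ : sdoStops M ε (sdoState M getNash argminSel argmaxSel k l u v t)), (t : ℕ∞)

/-- The game `U`: `0` on the diagonal, `2` just below it and `1` further below,
`-2` just above it and `-1` further above. -/
def gameU (n : ℕ) : Matrix (Fin n) (Fin n) ℝ := fun i j =>
  if (i : ℕ) = j then 0
  else if (i : ℕ) = j + 1 then 2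
  else if (j : ℕ) < i then 1
  else if (j : ℕ) = i + 1 then -2
  else -1

/-- All the perturbations `u t i` and `v t j` (over all times and all indices) are
independent and uniformly distributed on `[-1, 1]`. -/
def IsIIDUniformPerturbation {Ω : Type*} [MeasurableSpace Ω] (μ : Measure Ω)
    (u : ℕ → Fin m → Ω → ℝ) (v : ℕ → Fin n → Ω → ℝ) : Prop :=
  (∀ t i, Measurable (u t i)) ∧ (∀ t j, Measurable (v t j)) ∧
  (∀ t i, pdf.IsUniform (u t i) (Set.Icc (-1) 1) μ volume) ∧
  (∀ t j, pdf.IsUniform (v t j) (Set.Icc (-1) 1) μ volume) ∧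
  iIndepFun (fun x : (ℕ × Fin m) ⊕ (ℕ × Fin n) =>
    Sum.elim (fun y => u y.1 y.2) (fun y => v y.1 y.2) x) μ

end MatrixGame

end

/-! Let `r` and `c` be the smallest indices in `R` and `C`, and suppose `r ≤ c`. The subgame
strategy `q` lives on columns `≥ r`, where row `r` of `U` is nonpositive. The equilibrium property
therefore gives `(pᵀU)_c ≤ (Uq)_r ≤ 0`. This sign is the only consequence of equilibrium that the
halving argument needs (`IsSubgameNash.vecMul_gameU_nonpos`).

It forces the mass `x` of `p` above `c` to be at most `2/3`. Up to corrections of total mass at most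
one in each direction, `(pᵀU)_j` is the decreasing function "mass above `j` minus mass below `j`". A
threshold `τ` can then be placed so that the entries of `pᵀU + v` with index `≤ c/2` exceed it `1/6`
times in expectation or more. The remaining entries exceed it at most `7/4` times in expectation,
none with probability above `7/8` (`exists_threshold`). By independence, with probability at least
the absolute constant `halvingProb`, only entries with index `≤ c/2` exceed `τ`, and at least one
does, so the perturbed best response at least halves `c` (`exists_halvingProb_le`). The case `c < r`
is the mirror image, since `U` is skew-symmetric.

Thus the total number of binary digits of the two minima, which never increases, drops with at least
this probability in each pass until both are `0`. Since it starts at `O(log n)`, the expected number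
of such passes is `O(log n)`. Once index `0` is available to both players, the next subgame
equilibrium is `(e_0, e_0)` in zero-based indexing, and the loop ends. Conversely, a gap below `1`
already forces this equilibrium, so the loop cannot end anywhere else. -/

namespace MatrixGame

/-! ### Payoffs of the game against a mixed strategy, and the choice of a threshold -/

section Potential

variable {n : ℕ}

/-- The mass that `p` puts on indices above `j`. -/
noncomputable def massAbove (p : Fin n → ℝ) (j : Fin n) : ℝ := ∑ i : Fin n, if (j : ℕ) < i then p i else 0

/-- The mass that `p` puts on indices below `j`. -/
noncomputable def massBelow (p : Fin n → ℝ) (j : Fin n) : ℝ := ∑ i : Fin n, if (i : ℕ) < j then p i else 0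

/-- The mass that `p` puts on the successor of `j`. -/
noncomputable def massSucc (p : Fin n → ℝ) (j : Fin n) : ℝ := ∑ i : Fin n, if (i : ℕ) = j + 1 then p i else 0

/-- The mass that `p` puts on the predecessor of `j`. -/
noncomputable def massPred (p : Fin n → ℝ) (j : Fin n) : ℝ := ∑ i : Fin n, if (j : ℕ) = i + 1 then p i else 0

theorem gameU_transpose (n : ℕ) : (gameU n)ᵀ = -gameU n := by
  ext i j
  simp only [Matrix.transpose_apply, Matrix.neg_apply, gameU]
  split_ifs <;> first | omega | norm_num

theorem gameU_mulVec (q : Fin n → ℝ) : gameU n *ᵥ q = -(q ᵥ* gameU n) := by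
  rw [← Matrix.vecMul_transpose, gameU_transpose, Matrix.vecMul_neg]

theorem vecMul_gameU_apply (p : Fin n → ℝ) (j : Fin n) :
    (p ᵥ* gameU n) j = massAbove p j + massSucc p j - massBelow p j - massPred p j := by
  simp only [Matrix.vecMul, dotProduct, massAbove, massSucc, massBelow, massPred, gameU,
    ← Finset.sum_add_distrib, ← Finset.sum_sub_distrib]
  refine Finset.sum_congr rfl fun i _ => ?_
  split_ifs <;> first | omega | ring

variable {p : Fin n → ℝ}

theorem massAbove_nonneg (hp : ∀ i, 0 ≤ p i) (j : Fin n) : 0 ≤ massAbove p j :=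
  Finset.sum_nonneg fun i _ => by split_ifs <;> simp [hp i]

theorem massBelow_nonneg (hp : ∀ i, 0 ≤ p i) (j : Fin n) : 0 ≤ massBelow p j :=
  Finset.sum_nonneg fun i _ => by split_ifs <;> simp [hp i]

theorem massSucc_nonneg (hp : ∀ i, 0 ≤ p i) (j : Fin n) : 0 ≤ massSucc p j :=
  Finset.sum_nonneg fun i _ => by split_ifs <;> simp [hp i]

theorem massPred_nonneg (hp : ∀ i, 0 ≤ p i) (j : Fin n) : 0 ≤ massPred p j :=
  Finset.sum_nonneg fun i _ => by split_ifs <;> simp [hp i]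

theorem massSucc_le_massAbove (hp : ∀ i, 0 ≤ p i) (j : Fin n) :
    massSucc p j ≤ massAbove p j :=
  Finset.sum_le_sum fun i _ => by split_ifs <;> first | omega | simp [hp i]

theorem massPred_le_massBelow (hp : ∀ i, 0 ≤ p i) (j : Fin n) :
    massPred p j ≤ massBelow p j :=
  Finset.sum_le_sum fun i _ => by split_ifs <;> first | omega | simp [hp i]

theorem massAbove_antitone (hp : ∀ i, 0 ≤ p i) {i j : Fin n} (h : i ≤ j) :
    massAbove p j ≤ massAbove p i :=
  Finset.sum_le_sum fun k _ => by
    have : (i : ℕ) ≤ j := h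
    split_ifs <;> first | omega | simp [hp k]

theorem massBelow_mono (hp : ∀ i, 0 ≤ p i) {i j : Fin n} (h : i ≤ j) :
    massBelow p i ≤ massBelow p j :=
  Finset.sum_le_sum fun k _ => by
    have : (i : ℕ) ≤ j := h
    split_ifs <;> first | omega | simp [hp k]

theorem massAbove_add_self_add_massBelow (p : Fin n → ℝ) (j : Fin n) :
    massAbove p j + p j + massBelow p j = ∑ i, p i := by
  have : p j = ∑ i : Fin n, if (i : ℕ) = j then p i else 0 := by
    simp [Fin.val_inj]
  rw [this]
  simp only [massAbove, massBelow, ← Finset.sum_add_distrib]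
  refine Finset.sum_congr rfl fun i _ => ?_
  split_ifs <;> first | omega | simp

/-- Each `i` is the successor of at most one `j`, so no mass is counted twice. -/
theorem sum_massSucc_le (hp : ∀ i, 0 ≤ p i) (s : Finset (Fin n)) :
    ∑ j ∈ s, massSucc p j ≤ ∑ i, p i := by
  refine (Finset.sum_le_univ_sum_of_nonneg fun j => massSucc_nonneg hp j).trans ?_
  unfold massSucc
  rw [Finset.sum_comm]
  refine Finset.sum_le_sum fun i _ => ?_
  rw [← Finset.sum_filter, Finset.sum_const, nsmul_eq_mul]
  have : (Finset.univ.filter fun j : Fin n => (i : ℕ) = j + 1).card ≤ 1 :=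
    Finset.card_le_one.2 fun a ha b hb => by
      simp only [Finset.mem_filter, Finset.mem_univ, true_and] at ha hb
      exact Fin.ext (by omega)
  exact mul_le_of_le_one_left (hp i) (by exact_mod_cast this)

theorem sum_massPred_le (hp : ∀ i, 0 ≤ p i) (s : Finset (Fin n)) :
    ∑ j ∈ s, massPred p j ≤ ∑ i, p i := by
  refine (Finset.sum_le_univ_sum_of_nonneg fun j => massPred_nonneg hp j).trans ?_
  unfold massPred
  rw [Finset.sum_comm]
  refine Finset.sum_le_sum fun i _ => ?_
  rw [← Finset.sum_filter, Finset.sum_const, nsmul_eq_mul]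
  have : (Finset.univ.filter fun j : Fin n => (j : ℕ) = i + 1).card ≤ 1 :=
    Finset.card_le_one.2 fun a ha b hb => by
      simp only [Finset.mem_filter, Finset.mem_univ, true_and] at ha hb
      exact Fin.ext (by omega)
  exact mul_le_of_le_one_left (hp i) (by exact_mod_cast this)

/-- The probability that a uniform variable on `[-1, 1]` exceeds `-x`. -/
noncomputable def uniformTail (x : ℝ) : ℝ := max 0 (min 1 ((1 + x) / 2))

/-- The three bounds concern the expected numbers of entries of `pᵀU + v` above `τ`. The first makes
some low exceedance likely. The other two keep the probability of no high exceedance away from zero: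
the bound on the sum alone would not exclude a single entry that exceeds `τ` almost surely. -/
theorem exists_threshold (hp : p ∈ stdSimplex ℝ (Fin n)) (c : Fin n) (hc : 1 ≤ (c : ℕ))
    (hw : (p ᵥ* gameU n) c ≤ 0) :
    ∃ τ : ℝ,
      1 / 6 ≤ ∑ j ∈ Finset.univ.filter (fun j : Fin n => (j : ℕ) ≤ c / 2), uniformTail ((p ᵥ* gameU n) j - τ) ∧
      (∀ j : Fin n, (c : ℕ) / 2 < j → uniformTail ((p ᵥ* gameU n) j - τ) ≤ 7 / 8) ∧
      ∑ j ∈ Finset.univ.filter (fun j : Fin n => ¬ (j : ℕ) ≤ c / 2), uniformTail ((p ᵥ* gameU n) j - τ) ≤ 7 / 4 := by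
  obtain ⟨hp0, hp1⟩ := hp
  set h : ℕ := (c : ℕ) / 2 with hh
  have hhn : h < n := by have := c.2; omega
  set x := massAbove p c with hx
  have hx0 : 0 ≤ x := massAbove_nonneg hp0 c
  -- The sign of `(pᵀU)_c` gives `x ≤ below + pred ≤ 2 * below ≤ 2 * (1 - x)`.
  have hx1 : x ≤ 2 / 3 := by
    rw [vecMul_gameU_apply] at hw
    have h1 := massAbove_add_self_add_massBelow p c
    have h2 := massPred_le_massBelow hp0 c
    have h3 := massSucc_nonneg hp0 c
    have h4 := hp0 c
    linarith
  set a : Fin n → ℝ := fun j => massAbove p j - massBelow p j with ha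
  have ha_anti : ∀ {i j : Fin n}, i ≤ j → a j ≤ a i := fun {i j} hij =>
    sub_le_sub (massAbove_antitone hp0 hij) (massBelow_mono hp0 hij)
  have ha1 : ∀ j, a j ≤ 1 := fun j => by
    have h1 := massAbove_add_self_add_massBelow p j
    have h2 := massBelow_nonneg hp0 j
    have h4 := hp0 j
    simp only [ha]; linarith
  -- `S τ` is the expected number of low exceedances when the successor and predecessor corrections
  -- and the cap at probability `1` are ignored.
  set S : ℝ → ℝ := fun τ => ∑ j ∈ Finset.univ.filter (fun j : Fin n => (j : ℕ) ≤ h), max 0 ((1 + a j - τ) / 2) with hS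
  have hScont : Continuous S := by fun_prop
  have hS3 : S 3 = 0 := Finset.sum_eq_zero fun j _ => max_eq_left (by have := ha1 j; linarith)
  -- Lower `τ` from `3`, where `S` vanishes, until `S` reaches `3/4`, but stop at `2 * x`. The bound
  -- `2 * x ≤ τ` controls indices `≥ c`, while `S τ ≤ 3/4` controls those between `h` and `c`.
  obtain ⟨τ, hτ, hSτ, hor⟩ : ∃ τ, 2 * x ≤ τ ∧ S τ ≤ 3 / 4 ∧ (τ = 2 * x ∨ S τ = 3 / 4) := by
    by_cases hle : S (2 * x) ≤ 3 / 4
    · exact ⟨2 * x, le_rfl, hle, Or.inl rfl⟩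
    · have := intermediate_value_Icc' (by linarith : 2 * x ≤ 3) hScont.continuousOn
      obtain ⟨τ, h1, h2⟩ := this ⟨by rw [hS3]; norm_num, (not_le.1 hle).le⟩
      exact ⟨τ, h1.1, h2.le, Or.inr h2⟩
  have hwa : ∀ j, (p ᵥ* gameU n) j = a j + massSucc p j - massPred p j := fun j => by
    rw [vecMul_gameU_apply]; simp only [ha]; ring
  -- the part of the tail probability that comes from `a`
  have hM : ∀ j : Fin n, h < j → max 0 ((1 + a j - τ) / 2) * (h + 1) ≤ S τ := by
    intro j hj
    have hcard : (Finset.univ.filter fun i : Fin n => (i : ℕ) ≤ h).card = h + 1 := by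
      have : (Finset.univ.filter fun i : Fin n => (i : ℕ) ≤ h) = Finset.Iic ⟨h, hhn⟩ := by
        ext i; simp [Fin.le_def]
      rw [this, Fin.card_Iic]
    have := Finset.card_nsmul_le_sum (Finset.univ.filter fun i : Fin n => (i : ℕ) ≤ h)
      (fun i => max 0 ((1 + a i - τ) / 2)) (max 0 ((1 + a j - τ) / 2)) (by
        intro i hi
        simp only [Finset.mem_filter, Finset.mem_univ, true_and] at hi
        have := ha_anti (i := i) (j := j) (by rw [Fin.le_def]; omega)
        gcongr)
    rw [hcard, nsmul_eq_mul] at this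
    push_cast at this
    rw [mul_comm]; exact this
  -- An index strictly between `h = c / 2` and `c` exists only if `h ≥ 1`, so at least two low terms
  -- dominate this one, and it is at most half of `3/4`.
  have hM' : ∀ j : Fin n, h < j → (j : ℕ) < c → max 0 ((1 + a j - τ) / 2) ≤ 3 / 8 := by
    intro j hj hjc
    have h1 := hM j hj
    have h2 : (1 : ℝ) ≤ h := by
      have : 1 ≤ h := by omega
      exact_mod_cast this
    have h3 : 0 ≤ max 0 ((1 + a j - τ) / 2) := le_max_left _ _
    nlinarith
  -- For `j ≥ c`, total mass one gives `1 + a j = 2 * massAbove p j + p j ≤ 2 * x + p j ≤ τ + p j`,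
  -- which leaves only `p j / 2`.
  have hhigh : ∀ j : Fin n, uniformTail ((p ᵥ* gameU n) j - τ) ≤
      (if (j : ℕ) < c then max 0 ((1 + a j - τ) / 2) else p j / 2) + massSucc p j / 2 := by
    intro j
    have h1 := massSucc_nonneg hp0 j
    have h2 := massPred_nonneg hp0 j
    have h3 := hwa j
    unfold uniformTail
    split_ifs with hjc
    · have h4 := le_max_left 0 ((1 + a j - τ) / 2)
      have h5 := le_max_right 0 ((1 + a j - τ) / 2)
      refine max_le (by linarith) ((min_le_right _ _).trans ?_)
      linarith
    · have h4 := hp0 j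
      refine max_le (by linarith) ((min_le_right _ _).trans ?_)
      have h5 := massAbove_add_self_add_massBelow p j
      have h6 : massAbove p j ≤ x := massAbove_antitone hp0 (by rw [Fin.le_def]; omega)
      simp only [ha] at h3
      linarith
  refine ⟨τ, ?_, ?_, ?_⟩
  -- If `τ = 2 * x`, index `0` alone suffices: its payoff is at least `x`, so its tail is at least
  -- `(1 - x) / 2 ≥ 1/6`.
  · rcases hor with rfl | hS34
    · have hn : 0 < n := by omega
      have h0 : 1 / 6 ≤ uniformTail ((p ᵥ* gameU n) ⟨0, hn⟩ - 2 * x) := by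
        have h1 : massBelow p ⟨0, hn⟩ = 0 := by simp [massBelow]
        have h2 : massPred p ⟨0, hn⟩ = 0 := by simp [massPred]
        have h3 := massSucc_nonneg hp0 ⟨0, hn⟩
        have h4 : x ≤ massAbove p ⟨0, hn⟩ := massAbove_antitone hp0 (by simp [Fin.le_def])
        rw [vecMul_gameU_apply, h1, h2]
        unfold uniformTail
        exact le_max_of_le_right (le_min (by norm_num) (by linarith))
      refine h0.trans (Finset.single_le_sum
        (f := fun j => uniformTail ((p ᵥ* gameU n) j - 2 * x)) (fun j _ => le_max_left _ _) ?_)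
      simp
    -- If `S τ = 3/4`, no term reaches the cap `1`, and the predecessor corrections cost at most
    -- `1/2` in total, leaving `1/4`.
    · have h1 : ∑ j ∈ Finset.univ.filter (fun j : Fin n => (j : ℕ) ≤ h), (max 0 ((1 + a j - τ) / 2) - massPred p j / 2) ≤
          ∑ j ∈ Finset.univ.filter (fun j : Fin n => (j : ℕ) ≤ h), uniformTail ((p ᵥ* gameU n) j - τ) := by
        refine Finset.sum_le_sum fun j hj => ?_
        have h2 : max 0 ((1 + a j - τ) / 2) ≤ S τ :=
          Finset.single_le_sum (f := fun j => max 0 ((1 + a j - τ) / 2))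
            (fun j _ => le_max_left _ _) hj
        have h3 := massSucc_nonneg hp0 j
        have h4 := massPred_nonneg hp0 j
        have h5 := hwa j
        unfold uniformTail
        rcases le_total ((1 + a j - τ) / 2) 0 with h6 | h6
        · rw [max_eq_left h6]
          exact le_max_of_le_left (by linarith)
        · rw [max_eq_right h6] at h2 ⊢
          exact le_max_of_le_right (le_min (by linarith) (by linarith))
      rw [Finset.sum_sub_distrib, ← Finset.sum_div] at h1
      have h2 := sum_massPred_le hp0 (Finset.univ.filter fun j : Fin n => (j : ℕ) ≤ h)
      have h3 : ∑ j ∈ Finset.univ.filter (fun j : Fin n => (j : ℕ) ≤ h), max 0 ((1 + a j - τ) / 2) = 3 / 4 := hS34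
      linarith
  · intro j hj
    refine (hhigh j).trans ?_
    have h1 := massSucc_le_massAbove hp0 j
    have h2 := massAbove_add_self_add_massBelow p j
    have h3 := massBelow_nonneg hp0 j
    have h4 := hp0 j
    split_ifs with hjc
    · have := hM' j hj hjc
      linarith
    · linarith
  · refine (Finset.sum_le_sum fun j _ => hhigh j).trans ?_
    rw [Finset.sum_add_distrib, ← Finset.sum_div, Finset.sum_ite, ← Finset.sum_div]
    have h1 := sum_massSucc_le hp0 (Finset.univ.filter fun j : Fin n => ¬ (j : ℕ) ≤ h)
    have h2 : ∀ s : Finset (Fin n), ∑ j ∈ s, p j ≤ 1 := fun s =>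
      hp1 ▸ Finset.sum_le_univ_sum_of_nonneg hp0
    -- There are at most `h + 1` indices strictly between `h` and `c`, each contributing at most `S
    -- τ / (h + 1)`. With `1/2` from the successor terms and `1/2` from the indices `≥ c`, the total
    -- is `7/4`.
    have h3 : ∑ j ∈ (Finset.univ.filter fun j : Fin n => ¬ (j : ℕ) ≤ h).filter
        (fun j : Fin n => (j : ℕ) < c),
        max 0 ((1 + a j - τ) / 2) ≤ 3 / 4 := by
      rw [Finset.filter_filter]
      have hcard : (Finset.univ.filter fun j : Fin n => ¬ (j : ℕ) ≤ h ∧ (j : ℕ) < c).card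
          ≤ h + 1 := by
        have h5 : (Finset.univ.filter fun j : Fin n => ¬ (j : ℕ) ≤ h ∧ (j : ℕ) < c) ⊆
            Finset.Ioo ⟨h, hhn⟩ c := by
          intro i hi
          simp only [Finset.mem_filter, Finset.mem_univ, true_and, not_le] at hi
          exact Finset.mem_Ioo.2 hi
        refine (Finset.card_le_card h5).trans ?_
        rw [Fin.card_Ioo]
        simp only; omega
      refine le_trans (Finset.sum_le_card_nsmul _ _ (S τ / (h + 1)) ?_) ?_
      · intro j hj
        simp only [Finset.mem_filter, Finset.mem_univ, true_and, not_le] at hj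
        rw [le_div_iff₀ (by positivity)]
        exact hM j hj.1
      · rw [nsmul_eq_mul]
        have h6 : 0 ≤ S τ := Finset.sum_nonneg fun j _ => le_max_left _ _
        calc _ ≤ ((h + 1 : ℕ) : ℝ) * (S τ / (h + 1)) := by gcongr
          _ = S τ := by push_cast; field_simp
          _ ≤ _ := hSτ
    have h4 := h2 ((Finset.univ.filter fun j : Fin n => ¬ (j : ℕ) ≤ h).filter
      fun j => ¬ (j : ℕ) < c)
    linarith

end Potential

/-! ### Equilibria of subgames: signs of payoffs, and uniqueness of the full equilibrium -/

section Subgame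

variable {n : ℕ}

theorem IsNash.vecMul_le_mulVec {ι κ : Type*} [Fintype ι] [Fintype κ] {M : Matrix ι κ ℝ}
    {p : ι → ℝ} {q : κ → ℝ} (h : IsNash M p q) (i : ι) (j : κ) :
    (p ᵥ* M) j ≤ (M *ᵥ q) i := by
  obtain ⟨-, -, h1, h2⟩ := h
  have h3 : brValRow M q ≤ (M *ᵥ q) i := ciInf_le (Set.finite_range _).bddBelow i
  have h4 : (p ᵥ* M) j ≤ brValCol M p := le_ciSup (Set.finite_range _).bddAbove j
  linarith

theorem mem_stdSimplex_of_restrict {ι : Type*} [Fintype ι] {R : Finset ι} {p : ι → ℝ}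
    (h0 : ∀ i, i ∉ R → p i = 0) (h : (fun i : R => p i) ∈ stdSimplex ℝ R) :
    p ∈ stdSimplex ℝ ι := by
  refine ⟨fun i => ?_, ?_⟩
  · by_cases hi : i ∈ R
    · exact h.1 ⟨i, hi⟩
    · rw [h0 i hi]
  · rw [← h.2, Finset.sum_coe_sort R p]
    exact (Finset.sum_subset (Finset.subset_univ R) fun i _ hi => h0 i hi).symm

theorem IsSubgameNash.vecMul_le_mulVec {ι κ : Type*} [Fintype ι] [Fintype κ] {M : Matrix ι κ ℝ}
    {R : Finset ι} {C : Finset κ} {p : ι → ℝ} {q : κ → ℝ} (h : IsSubgameNash M R C p q)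
    {i : ι} {j : κ} (hi : i ∈ R) (hj : j ∈ C) : (p ᵥ* M) j ≤ (M *ᵥ q) i := by
  have h1 := h.2.2.vecMul_le_mulVec ⟨i, hi⟩ ⟨j, hj⟩
  simp only [Matrix.vecMul, Matrix.mulVec, dotProduct, Matrix.submatrix_apply] at h1 ⊢
  rw [Finset.sum_coe_sort R fun i => p i * M i j, Finset.sum_coe_sort C fun j => M i j * q j,
    Finset.sum_subset (Finset.subset_univ R) fun k _ hk => by rw [h.1 k hk, zero_mul],
    Finset.sum_subset (Finset.subset_univ C) fun k _ hk => by rw [h.2.1 k hk, mul_zero]] at h1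
  exact h1

/-- Row `r` of `U` is positive only at columns below `r`, which `q` does not use. -/
theorem mulVec_gameU_nonpos {q : Fin n → ℝ} (hq : ∀ j, 0 ≤ q j) {r : Fin n}
    (h : ∀ j, j < r → q j = 0) : (gameU n *ᵥ q) r ≤ 0 := by
  rw [gameU_mulVec, Pi.neg_apply, vecMul_gameU_apply]
  have h1 : massBelow q r = 0 := Finset.sum_eq_zero fun i _ => by
    split_ifs with hi
    · exact h i hi
    · rfl
  have h2 := massPred_le_massBelow hq r
  have h3 := massAbove_nonneg hq r
  have h4 := massSucc_nonneg hq r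
  linarith

theorem vecMul_gameU_nonneg {p : Fin n → ℝ} (hp : ∀ j, 0 ≤ p j) {c : Fin n}
    (h : ∀ j, j < c → p j = 0) : 0 ≤ (p ᵥ* gameU n) c := by
  have := mulVec_gameU_nonpos hp h
  rw [gameU_mulVec, Pi.neg_apply] at this
  linarith

theorem IsSubgameNash.vecMul_gameU_nonpos {R C : Finset (Fin n)} {p q : Fin n → ℝ}
    (h : IsSubgameNash (gameU n) R C p q) {r c : Fin n} (hr : r ∈ R) (hc : c ∈ C)
    (hmin : ∀ j ∈ C, c ≤ j) (hrc : r ≤ c) : (p ᵥ* gameU n) c ≤ 0 :=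
  (h.vecMul_le_mulVec hr hc).trans <|
    mulVec_gameU_nonpos (mem_stdSimplex_of_restrict h.2.1 h.2.2.2.1).1 fun j hj =>
      h.2.1 j fun hjC => absurd (hmin j hjC) (not_le.2 (hj.trans_le hrc))

/-- The mirror case. By skew-symmetry it is again a statement about `ᵥ* gameU n`, so the same
threshold lemma applies to `q` and `r`. -/
theorem IsSubgameNash.vecMul_gameU_nonpos' {R C : Finset (Fin n)} {p q : Fin n → ℝ}
    (h : IsSubgameNash (gameU n) R C p q) {r c : Fin n} (hr : r ∈ R) (hc : c ∈ C)
    (hmin : ∀ i ∈ R, r ≤ i) (hcr : c ≤ r) : (q ᵥ* gameU n) r ≤ 0 := by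
  have h1 := h.vecMul_le_mulVec hr hc
  rw [gameU_mulVec, Pi.neg_apply] at h1
  have h2 : 0 ≤ (p ᵥ* gameU n) c :=
    vecMul_gameU_nonneg (mem_stdSimplex_of_restrict h.1 h.2.2.1).1 fun j hj =>
      h.1 j fun hjR => absurd (hmin j hjR) (not_le.2 (hj.trans_le hcr))
  linarith

/-- Column `0` pays at least `1` against every row other than row `0`. -/
theorem one_sub_le_vecMul_gameU_zero {p : Fin n → ℝ} (hp : p ∈ stdSimplex ℝ (Fin n))
    (hn : 0 < n) : 1 - p ⟨0, hn⟩ ≤ (p ᵥ* gameU n) ⟨0, hn⟩ := by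
  have h1 : massBelow p ⟨0, hn⟩ = 0 := by simp [massBelow]
  have h2 : massPred p ⟨0, hn⟩ = 0 := by simp [massPred]
  have h3 := massSucc_nonneg hp.1 ⟨0, hn⟩
  have h4 := massAbove_add_self_add_massBelow p ⟨0, hn⟩
  rw [hp.2] at h4
  rw [vecMul_gameU_apply]
  linarith

theorem mulVec_gameU_zero_le {q : Fin n → ℝ} (hq : q ∈ stdSimplex ℝ (Fin n))
    (hn : 0 < n) : (gameU n *ᵥ q) ⟨0, hn⟩ ≤ q ⟨0, hn⟩ - 1 := by
  have := one_sub_le_vecMul_gameU_zero hq hn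
  rw [gameU_mulVec, Pi.neg_apply]
  linarith

theorem le_one_of_mem_stdSimplex {p : Fin n → ℝ} (hp : p ∈ stdSimplex ℝ (Fin n)) (i : Fin n) :
    p i ≤ 1 :=
  hp.2 ▸ Finset.single_le_sum (f := p) (fun j _ => hp.1 j) (Finset.mem_univ i)

theorem eq_single_of_mem_stdSimplex {p : Fin n → ℝ} (hp : p ∈ stdSimplex ℝ (Fin n)) {i : Fin n}
    (hi : 1 ≤ p i) : p = Pi.single i 1 := by
  have h1 : p i = 1 := le_antisymm (le_one_of_mem_stdSimplex hp i) hi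
  ext j
  by_cases hj : j = i
  · subst hj; simpa using h1
  · rw [Pi.single_eq_of_ne hj]
    have h2 := Finset.add_sum_erase Finset.univ p (Finset.mem_univ i)
    have h3 : ∑ k ∈ Finset.univ.erase i, p k = 0 := by
      have := hp.2
      linarith
    exact (Finset.sum_eq_zero_iff_of_nonneg fun k _ => hp.1 k).1 h3 j (by simp [hj])

/-- The bounds `(Uq)_0 ≤ q_0 - 1 ≤ 0 ≤ 1 - p_0 ≤ (pᵀU)_0` close up to equalities. A single
inequality at index `0` thus suffices, so the lemma serves both the full game and every subgame
containing index `0` for both players. -/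
theorem eq_single_zero_of_vecMul_le {p q : Fin n → ℝ} (hp : p ∈ stdSimplex ℝ (Fin n))
    (hq : q ∈ stdSimplex ℝ (Fin n)) (hn : 0 < n)
    (h : (p ᵥ* gameU n) ⟨0, hn⟩ ≤ (gameU n *ᵥ q) ⟨0, hn⟩) :
    p = Pi.single ⟨0, hn⟩ 1 ∧ q = Pi.single ⟨0, hn⟩ 1 := by
  have h1 := one_sub_le_vecMul_gameU_zero hp hn
  have h2 := mulVec_gameU_zero_le hq hn
  have h3 := le_one_of_mem_stdSimplex hp ⟨0, hn⟩
  have h4 := le_one_of_mem_stdSimplex hq ⟨0, hn⟩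
  exact ⟨eq_single_of_mem_stdSimplex hp (by linarith), eq_single_of_mem_stdSimplex hq (by linarith)⟩

theorem brValCol_single_zero (hn : 0 < n) :
    brValCol (gameU n) (Pi.single ⟨0, hn⟩ 1) ≤ 0 := by
  have : Nonempty (Fin n) := ⟨⟨0, hn⟩⟩
  refine ciSup_le fun j => ?_
  rw [Matrix.single_one_vecMul]
  simp only [Matrix.row_apply, gameU]
  split_ifs <;> first | omega | (norm_num; done) | simp_all

theorem brValRow_single_zero (hn : 0 < n) :
    0 ≤ brValRow (gameU n) (Pi.single ⟨0, hn⟩ 1) := by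
  have : Nonempty (Fin n) := ⟨⟨0, hn⟩⟩
  refine le_ciInf fun j => ?_
  rw [Matrix.mulVec_single_one]
  simp only [Matrix.col_apply, gameU]
  split_ifs <;> first | omega | norm_num

theorem isNash_gameU_iff (hn : 0 < n) (p q : Fin n → ℝ) :
    IsNash (gameU n) p q ↔ p = Pi.single ⟨0, hn⟩ 1 ∧ q = Pi.single ⟨0, hn⟩ 1 := by
  refine ⟨fun h => eq_single_zero_of_vecMul_le h.1 h.2.1 hn (h.vecMul_le_mulVec _ _), ?_⟩
  rintro ⟨rfl, rfl⟩
  have h1 := brValCol_single_zero hn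
  have h2 := brValRow_single_zero hn
  have h3 : outcome (gameU n) (Pi.single ⟨0, hn⟩ 1) (Pi.single ⟨0, hn⟩ 1) = 0 := by
    simp [outcome, gameU]
  exact ⟨single_mem_stdSimplex ℝ _, single_mem_stdSimplex ℝ _, by linarith, by linarith⟩

theorem IsSubgameNash.eq_single_zero {R C : Finset (Fin n)} {p q : Fin n → ℝ}
    (h : IsSubgameNash (gameU n) R C p q) (hn : 0 < n) (hR : ⟨0, hn⟩ ∈ R) (hC : ⟨0, hn⟩ ∈ C) :
    p = Pi.single ⟨0, hn⟩ 1 ∧ q = Pi.single ⟨0, hn⟩ 1 :=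
  eq_single_zero_of_vecMul_le (mem_stdSimplex_of_restrict h.1 h.2.2.1)
    (mem_stdSimplex_of_restrict h.2.1 h.2.2.2.1) hn (h.vecMul_le_mulVec hR hC)

/-- The gap is at least `(1 - p_0) + (1 - q_0)`. This is where `ε < 1` becomes decisive. -/
theorem ne_zero_of_gap_lt_one {p q : Fin n → ℝ} (hp : p ∈ stdSimplex ℝ (Fin n))
    (hq : q ∈ stdSimplex ℝ (Fin n)) (hn : 0 < n)
    (h : brValCol (gameU n) p - brValRow (gameU n) q < 1) :
    p ⟨0, hn⟩ ≠ 0 ∧ q ⟨0, hn⟩ ≠ 0 := by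
  have h1 := one_sub_le_vecMul_gameU_zero hp hn
  have h2 := mulVec_gameU_zero_le hq hn
  have h3 : brValRow (gameU n) q ≤ (gameU n *ᵥ q) ⟨0, hn⟩ :=
    ciInf_le (Set.finite_range _).bddBelow _
  have h4 : (p ᵥ* gameU n) ⟨0, hn⟩ ≤ brValCol (gameU n) p :=
    le_ciSup (Set.finite_range _).bddAbove _
  have h5 := le_one_of_mem_stdSimplex hp ⟨0, hn⟩
  have h6 := le_one_of_mem_stdSimplex hq ⟨0, hn⟩
  constructor <;> intro h7 <;> linarith

end Subgame

/-! ### Termination along a single run -/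

section Run

variable {n : ℕ} {getNash : Finset (Fin n) → Finset (Fin n) → (Fin n → ℝ) × (Fin n → ℝ)}
  {argminSel argmaxSel : (Fin n → ℝ) → Fin n} {k l : Fin n} {u v : ℕ → Fin n → ℝ}

theorem sdoState_nonempty (M : Matrix (Fin n) (Fin n) ℝ) (t : ℕ) :
    (sdoState M getNash argminSel argmaxSel k l u v t).R.Nonempty ∧
      (sdoState M getNash argminSel argmaxSel k l u v t).C.Nonempty := by
  cases t with
  | zero => exact ⟨Finset.singleton_nonempty _, Finset.singleton_nonempty _⟩
  | succ t => exact ⟨Finset.insert_nonempty _ _, Finset.insert_nonempty _ _⟩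

theorem sdoStops_gameU_succ
    (hNash : ∀ R C : Finset (Fin n), R.Nonempty → C.Nonempty →
      IsSubgameNash (gameU n) R C (getNash R C).1 (getNash R C).2)
    {ε : ℝ} (hε : 0 ≤ ε) (hn : 0 < n) {t : ℕ}
    (hR : ⟨0, hn⟩ ∈ (sdoState (gameU n) getNash argminSel argmaxSel k l u v t).R)
    (hC : ⟨0, hn⟩ ∈ (sdoState (gameU n) getNash argminSel argmaxSel k l u v t).C) :
    sdoStops (gameU n) ε (sdoState (gameU n) getNash argminSel argmaxSel k l u v (t + 1)) := by
  have h := (hNash _ _ ⟨_, hR⟩ ⟨_, hC⟩).eq_single_zero hn hR hC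
  have h1 := brValCol_single_zero hn
  have h2 := brValRow_single_zero hn
  simp only [sdoStops, sdoState, sdoStep]
  rw [h.1, h.2]
  linarith

/-- Stopping means that both current strategies charge index `0`. After a pass, index `0` must have
been available to both players in the subgame just solved, whose equilibrium is then the exact one.
Before any pass, it means `k = l = 0`. -/
theorem isNash_of_sdoStops
    (hNash : ∀ R C : Finset (Fin n), R.Nonempty → C.Nonempty →
      IsSubgameNash (gameU n) R C (getNash R C).1 (getNash R C).2)
    {ε : ℝ} (hε : ε < 1) {t : ℕ}
    (h : sdoStops (gameU n) ε (sdoState (gameU n) getNash argminSel argmaxSel k l u v t)) :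
    IsNash (gameU n) (sdoState (gameU n) getNash argminSel argmaxSel k l u v t).p
      (sdoState (gameU n) getNash argminSel argmaxSel k l u v t).q := by
  have hn : 0 < n := k.pos
  rw [isNash_gameU_iff hn]
  have hlt := lt_of_le_of_lt h hε
  cases t with
  | zero =>
    have h0 := ne_zero_of_gap_lt_one (single_mem_stdSimplex ℝ k) (single_mem_stdSimplex ℝ l) hn hlt
    have hk : k = ⟨0, hn⟩ := by
      by_contra hk
      exact h0.1 (Pi.single_eq_of_ne (Ne.symm hk) _)
    have hl : l = ⟨0, hn⟩ := by
      by_contra hl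
      exact h0.2 (Pi.single_eq_of_ne (Ne.symm hl) _)
    subst hk hl
    exact ⟨rfl, rfl⟩
  | succ t =>
    obtain ⟨hR, hC⟩ := sdoState_nonempty (getNash := getNash) (argminSel := argminSel)
      (argmaxSel := argmaxSel) (k := k) (l := l) (u := u) (v := v) (gameU n) t
    have hN := hNash _ _ hR hC
    have h0 := ne_zero_of_gap_lt_one (mem_stdSimplex_of_restrict hN.1 hN.2.2.1)
      (mem_stdSimplex_of_restrict hN.2.1 hN.2.2.2.1) hn hlt
    exact hN.eq_single_zero hn (by by_contra hx; exact h0.1 (hN.1 _ hx))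
      (by by_contra hx; exact h0.2 (hN.2.1 _ hx))

theorem sdoIterations_le {M : Matrix (Fin n) (Fin n) ℝ} {ε : ℝ} {t : ℕ}
    (h : sdoStops M ε (sdoState M getNash argminSel argmaxSel k l u v t)) :
    sdoIterations M ε getNash argminSel argmaxSel k l u v ≤ t :=
  iInf₂_le t h

theorem exists_sdoStops_of_sdoIterations_ne_top {M : Matrix (Fin n) (Fin n) ℝ} {ε : ℝ}
    (h : sdoIterations M ε getNash argminSel argmaxSel k l u v ≠ ⊤) :
    ∃ T : ℕ, sdoIterations M ε getNash argminSel argmaxSel k l u v = T ∧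
      sdoStops M ε (sdoState M getNash argminSel argmaxSel k l u v T) := by
  classical
  have hex : ∃ t, sdoStops M ε (sdoState M getNash argminSel argmaxSel k l u v t) := by
    by_contra hno
    push Not at hno
    exact h (iInf₂_eq_top.2 fun t ht => absurd ht (hno t))
  refine ⟨Nat.find hex, le_antisymm (sdoIterations_le (Nat.find_spec hex)) ?_, Nat.find_spec hex⟩
  exact le_iInf₂ fun t ht => by exact_mod_cast Nat.find_min' hex ht

end Run

/-! ### Probability that a perturbed best response halves the minimal index -/

section Uniform

variable {Ω : Type*} [MeasurableSpace Ω] {μ : Measure Ω}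

theorem measureReal_le_of_isUniform [IsProbabilityMeasure μ] {X : Ω → ℝ} (hX : Measurable X)
    (h : pdf.IsUniform X (Set.Icc (-1) 1) μ volume) (t : ℝ) :
    μ.real {ω | X ω ≤ t} = 1 - uniformTail (-t) := by
  have h1 : {ω | X ω ≤ t} = X ⁻¹' Set.Iic t := rfl
  rw [h1, measureReal_def, ← Measure.map_apply hX measurableSet_Iic, h,
    cond_apply measurableSet_Icc]
  have h2 : Set.Icc (-1 : ℝ) 1 ∩ Set.Iic t = Set.Icc (-1) (min 1 t) := by
    ext x; simp only [Set.mem_inter_iff, Set.mem_Icc, Set.mem_Iic, le_min_iff]; tauto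
  rw [h2, Real.volume_Icc, Real.volume_Icc, ENNReal.toReal_mul, ENNReal.toReal_inv,
    ENNReal.toReal_ofReal (by norm_num), ENNReal.toReal_ofReal']
  unfold uniformTail
  rcases le_total 1 t with h3 | h3
  · rw [min_eq_left h3, min_eq_right (by linarith : (1 + -t) / 2 ≤ 1),
      max_eq_left (by linarith : (1 + -t) / 2 ≤ 0)]
    norm_num
  · rw [min_eq_right h3]
    rcases le_total (-1) t with h4 | h4
    · rw [max_eq_left (by linarith : 0 ≤ t - -1), min_eq_right (by linarith : (1 + -t) / 2 ≤ 1),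
        max_eq_right (by linarith : 0 ≤ (1 + -t) / 2)]
      ring
    · rw [max_eq_right (by linarith : t - -1 ≤ 0), min_eq_left (by linarith : 1 ≤ (1 + -t) / 2),
        max_eq_right zero_le_one]
      norm_num

/-- The probability with which the larger of the two minimal indices is at least halved. -/
noncomputable def halvingProb : ℝ := Real.exp (-14) * (1 - Real.exp (-(1 / 6)))

theorem halvingProb_pos : 0 < halvingProb :=
  mul_pos (Real.exp_pos _) (sub_pos.2 (Real.exp_lt_one_iff.2 (by norm_num)))

/-- The event that the largest entry of `w + x` is found at an index `≤ h`, certified by the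
threshold `τ`. -/
def thresholdSet {n : ℕ} (w : Fin n → ℝ) (h : ℕ) (τ : ℝ) : Set (Fin n → ℝ) :=
  {x | (∀ j : Fin n, ¬ (j : ℕ) ≤ h → x j ≤ τ - w j) ∧ ¬ ∀ j, x j ≤ τ - w j}

theorem measurableSet_thresholdSet {n : ℕ} (w : Fin n → ℝ) (h : ℕ) (τ : ℝ) :
    MeasurableSet (thresholdSet w h τ) := by
  unfold thresholdSet
  measurability

theorem le_of_mem_thresholdSet {n : ℕ} {w x : Fin n → ℝ} {h : ℕ} {τ : ℝ}
    (hx : x ∈ thresholdSet w h τ) {i : Fin n} (hi : ∀ j, w j + x j ≤ w i + x i) :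
    (i : ℕ) ≤ h := by
  obtain ⟨h1, h2⟩ := hx
  push Not at h2
  obtain ⟨j, hj⟩ := h2
  by_contra hih
  have := h1 i hih
  have := hi j
  linarith

/-- Here `1 - f ≥ 1/8`, so `(1 - f)⁻¹ = 1 + f / (1 - f) ≤ 1 + 8 * f`; then `log y ≥ 1 - y⁻¹`
applies. -/
theorem exp_neg_mul_le_one_sub {f : ℝ} (h1 : f ≤ 7 / 8) (h0 : 0 ≤ f) :
    Real.exp (-8 * f) ≤ 1 - f := by
  have h2 : (0 : ℝ) < 1 - f := by linarith
  rw [← Real.le_log_iff_exp_le h2]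
  refine le_trans ?_ (Real.one_sub_inv_le_log_of_pos h2)
  have h3 : (1 - f)⁻¹ ≤ 1 + 8 * f := by
    rw [inv_le_iff_one_le_mul₀ h2]
    nlinarith
  linarith

/-- By independence the event has probability `∏_H (1 - f) * (1 - ∏_L (1 - f))`, with `H` the high
and `L` the low indices. The first factor is at least `exp (-8 * (7/4)) = exp (-14)`, and the second
at least `1 - exp (-1/6)`. -/
theorem exists_halvingProb_le [IsProbabilityMeasure μ] {n : ℕ} {X : Fin n → Ω → ℝ}
    (hX : ∀ i, Measurable (X i))
    (hunif : ∀ i, pdf.IsUniform (X i) (Set.Icc (-1) 1) μ volume) (hind : iIndepFun X μ)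
    {p : Fin n → ℝ} (hp : p ∈ stdSimplex ℝ (Fin n)) (c : Fin n) (hc : 1 ≤ (c : ℕ))
    (hw : (p ᵥ* gameU n) c ≤ 0) :
    ∃ τ, halvingProb ≤
      μ.real {ω | (fun i => X i ω) ∈ thresholdSet (p ᵥ* gameU n) (c / 2) τ} := by
  obtain ⟨τ, hlow, hhigh, hsum⟩ := exists_threshold hp c hc hw
  refine ⟨τ, ?_⟩
  set w := p ᵥ* gameU n
  set f : Fin n → ℝ := fun j => uniformTail (w j - τ) with hf
  have hf0 : ∀ j, 0 ≤ f j := fun j => le_max_left _ _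
  have hf1 : ∀ j, f j ≤ 1 := fun j => max_le zero_le_one (min_le_left _ _)
  have hset : ∀ s : Finset (Fin n),
      μ.real (⋂ j ∈ s, X j ⁻¹' Set.Iic (τ - w j)) = ∏ j ∈ s, (1 - f j) := by
    intro s
    rw [measureReal_def, hind.measure_inter_preimage_eq_mul s fun j _ => measurableSet_Iic,
      ENNReal.toReal_prod]
    refine Finset.prod_congr rfl fun j _ => ?_
    have := measureReal_le_of_isUniform (hX j) (hunif j) (τ - w j)
    rw [neg_sub] at this
    exact this
  set H : Finset (Fin n) := Finset.univ.filter (fun j : Fin n => ¬ (j : ℕ) ≤ c / 2)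
  set L : Finset (Fin n) := Finset.univ.filter (fun j : Fin n => (j : ℕ) ≤ c / 2)
  -- Written as a difference of two nested intersections, so that each probability is a product.
  have hdiff : {ω | (fun i => X i ω) ∈ thresholdSet w (c / 2) τ} =
      (⋂ j ∈ H, X j ⁻¹' Set.Iic (τ - w j)) \
        (⋂ j ∈ (Finset.univ : Finset (Fin n)), X j ⁻¹' Set.Iic (τ - w j)) := by
    ext ω
    simp [thresholdSet, H]
  have hmeas : MeasurableSet (⋂ j ∈ (Finset.univ : Finset (Fin n)), X j ⁻¹' Set.Iic (τ - w j)) :=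
    Finset.measurableSet_biInter _ fun j _ => hX j measurableSet_Iic
  have hsub : (⋂ j ∈ (Finset.univ : Finset (Fin n)), X j ⁻¹' Set.Iic (τ - w j)) ⊆
      ⋂ j ∈ H, X j ⁻¹' Set.Iic (τ - w j) :=
    fun ω hω => by simp only [Set.mem_iInter] at hω ⊢; exact fun j _ => hω j (Finset.mem_univ j)
  rw [hdiff, measureReal_sdiff hsub hmeas, hset, hset]
  have hprod : ∏ j, (1 - f j) = (∏ j ∈ L, (1 - f j)) * ∏ j ∈ H, (1 - f j) :=
    (Finset.prod_filter_mul_prod_filter_not _ _ _).symm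
  have hL : ∏ j ∈ L, (1 - f j) ≤ Real.exp (-(1 / 6)) := by
    calc ∏ j ∈ L, (1 - f j) ≤ ∏ j ∈ L, Real.exp (-f j) :=
          Finset.prod_le_prod (fun j _ => sub_nonneg.2 (hf1 j)) fun j _ => Real.one_sub_le_exp_neg _
      _ = Real.exp (-∑ j ∈ L, f j) := by rw [← Real.exp_sum, Finset.sum_neg_distrib]
      _ ≤ _ := Real.exp_le_exp.2 (neg_le_neg hlow)
  have hH : Real.exp (-14) ≤ ∏ j ∈ H, (1 - f j) := by
    calc Real.exp (-14) ≤ Real.exp (-8 * ∑ j ∈ H, f j) :=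
          Real.exp_le_exp.2 (by
            have : ∑ j ∈ H, f j ≤ 7 / 4 := hsum
            linarith)
      _ = ∏ j ∈ H, Real.exp (-8 * f j) := by rw [← Real.exp_sum, Finset.mul_sum]
      _ ≤ _ := Finset.prod_le_prod (fun j _ => (Real.exp_pos _).le) fun j hj =>
          exp_neg_mul_le_one_sub (hhigh j (by simpa [H] using hj)) (hf0 j)
  have hlt : Real.exp (-(1 / 6)) < 1 := Real.exp_lt_one_iff.2 (by norm_num)
  calc halvingProb ≤ (∏ j ∈ H, (1 - f j)) * (1 - ∏ j ∈ L, (1 - f j)) :=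
        mul_le_mul hH (by linarith) (by linarith) ((Real.exp_pos _).le.trans hH)
    _ = _ := by rw [hprod]; ring

end Uniform

/-! ### The potential: binary lengths of the two minimal indices -/

section MinIndex

variable {n : ℕ}

/-- The smallest index in `R`. -/
noncomputable def minIdx (R : Finset (Fin n)) : ℕ := sInf (Fin.val '' (R : Set (Fin n)))

theorem minIdx_le {R : Finset (Fin n)} {i : Fin n} (hi : i ∈ R) : minIdx R ≤ i :=
  Nat.sInf_le ⟨i, hi, rfl⟩

theorem exists_eq_minIdx {R : Finset (Fin n)} (hR : R.Nonempty) :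
    ∃ r ∈ R, (r : ℕ) = minIdx R ∧ ∀ i ∈ R, r ≤ i := by
  obtain ⟨r, hr, hr'⟩ := Nat.sInf_mem (s := Fin.val '' (R : Set (Fin n)))
    (Set.Nonempty.image _ (Finset.coe_nonempty.2 hR))
  exact ⟨r, hr, hr', fun i hi => by rw [Fin.le_def, hr']; exact minIdx_le hi⟩

theorem minIdx_insert_le {R : Finset (Fin n)} (hR : R.Nonempty) (a : Fin n) :
    minIdx (insert a R) ≤ minIdx R := by
  obtain ⟨r, hr, hr', -⟩ := exists_eq_minIdx hR
  rw [← hr']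
  exact minIdx_le (Finset.mem_insert_of_mem hr)

theorem zero_mem_of_minIdx_eq_zero {R : Finset (Fin n)} (hR : R.Nonempty) (hn : 0 < n)
    (h : minIdx R = 0) : ⟨0, hn⟩ ∈ R := by
  obtain ⟨r, hr, hr', -⟩ := exists_eq_minIdx hR
  have : r = ⟨0, hn⟩ := Fin.ext (hr'.trans h)
  exact this ▸ hr

theorem size_half_lt {m : ℕ} (hm : 1 ≤ m) : (m / 2).size < m.size := by
  have h1 : 0 < m.size := Nat.size_pos.2 hm
  have h2 : m < 2 ^ m.size := Nat.lt_size_self m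
  have h3 : (m / 2).size ≤ m.size - 1 := by
    rw [Nat.size_le, Nat.div_lt_iff_lt_mul two_pos, ← pow_succ]
    rwa [Nat.sub_add_cancel h1]
  omega

/-- The number of binary digits of the two smallest indices in `R` and in `C`. -/
noncomputable def potential (x : Finset (Fin n) × Finset (Fin n)) : ℕ :=
  (minIdx x.1).size + (minIdx x.2).size

theorem potential_insert_le {R C : Finset (Fin n)} (hR : R.Nonempty) (hC : C.Nonempty)
    (a b : Fin n) : potential (insert a R, insert b C) ≤ potential (R, C) :=
  add_le_add (Nat.size_le_size (minIdx_insert_le hR a)) (Nat.size_le_size (minIdx_insert_le hC b))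

theorem potential_insert_lt_of_left {R C : Finset (Fin n)} (hC : C.Nonempty)
    {a b : Fin n} (h : 1 ≤ minIdx R) (ha : (a : ℕ) ≤ minIdx R / 2) :
    potential (insert a R, insert b C) < potential (R, C) :=
  add_lt_add_of_lt_of_le ((Nat.size_le_size ((minIdx_le (Finset.mem_insert_self a R)).trans
    ha)).trans_lt (size_half_lt h)) (Nat.size_le_size (minIdx_insert_le hC b))

theorem potential_insert_lt_of_right {R C : Finset (Fin n)} (hR : R.Nonempty)
    {a b : Fin n} (h : 1 ≤ minIdx C) (hb : (b : ℕ) ≤ minIdx C / 2) :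
    potential (insert a R, insert b C) < potential (R, C) :=
  add_lt_add_of_le_of_lt (Nat.size_le_size (minIdx_insert_le hR a))
    ((Nat.size_le_size ((minIdx_le (Finset.mem_insert_self b C)).trans
    hb)).trans_lt (size_half_lt h))

theorem potential_singleton_le (k l : Fin n) (hn : 2 ≤ n) :
    (potential (({k} : Finset (Fin n)), ({l} : Finset (Fin n))) : ℝ) ≤
      4 * (Real.log n / Real.log 2) := by
  have h1 : ∀ k : Fin n, (minIdx {k}).size ≤ Nat.log 2 n + 1 := fun k => by
    rw [Nat.size_le]
    exact ((minIdx_le (Finset.mem_singleton_self k)).trans_lt k.2).trans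
      (Nat.lt_pow_succ_log_self one_lt_two n)
  -- Each length is at most `Nat.log 2 n + 1 ≤ 2 * Nat.log 2 n`, which for two players gives the
  -- factor `4`.
  have h2 : 1 ≤ Nat.log 2 n := Nat.log_pos one_lt_two hn
  have h3 : potential (({k} : Finset (Fin n)), ({l} : Finset (Fin n))) ≤ 4 * Nat.log 2 n := by
    have := h1 k
    have := h1 l
    simp only [potential]
    omega
  have h4 := Real.natLog_le_logb n 2
  rw [Real.logb] at h4
  calc (potential (({k} : Finset (Fin n)), ({l} : Finset (Fin n))) : ℝ)
      ≤ ((4 * Nat.log 2 n : ℕ) : ℝ) := by exact_mod_cast h3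
    _ ≤ _ := by push_cast at h4 ⊢; linarith

end MinIndex

/-! ### Independence of the perturbations of different passes -/

section Independence

variable {m n : ℕ} {Ω : Type*}

/-- The `σ`-algebra generated by the perturbations of the iterations in `T`. -/
@[reducible]
def perturbationSigma (u : ℕ → Fin m → Ω → ℝ) (v : ℕ → Fin n → Ω → ℝ) (T : Set ℕ) :
    MeasurableSpace Ω :=
  ⨆ x ∈ {x : (ℕ × Fin m) ⊕ (ℕ × Fin n) | Sum.elim Prod.fst Prod.fst x ∈ T},
    MeasurableSpace.comap (Sum.elim (fun y => u y.1 y.2) (fun y => v y.1 y.2) x) inferInstance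

variable {u : ℕ → Fin m → Ω → ℝ} {v : ℕ → Fin n → Ω → ℝ}

theorem perturbationSigma_mono {S T : Set ℕ} (h : S ⊆ T) :
    perturbationSigma u v S ≤ perturbationSigma u v T :=
  biSup_mono fun _ hx => h hx

theorem comap_le_perturbationSigma {T : Set ℕ} (x : (ℕ × Fin m) ⊕ (ℕ × Fin n))
    (hx : Sum.elim Prod.fst Prod.fst x ∈ T) :
    MeasurableSpace.comap (Sum.elim (fun y => u y.1 y.2) (fun y => v y.1 y.2) x) inferInstance ≤
      perturbationSigma u v T :=
  le_biSup (fun x : (ℕ × Fin m) ⊕ (ℕ × Fin n) =>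
    MeasurableSpace.comap (Sum.elim (fun y => u y.1 y.2) (fun y => v y.1 y.2) x) inferInstance) hx

theorem measurable_left_perturbationSigma {T : Set ℕ} {t : ℕ} (ht : t ∈ T) :
    Measurable[perturbationSigma u v T] fun ω i => u t i ω :=
  @measurable_pi_lambda _ _ _ (perturbationSigma u v T) _ _ fun i =>
    measurable_iff_comap_le.2 (comap_le_perturbationSigma (u := u) (v := v) (Sum.inl (t, i)) ht)

theorem measurable_right_perturbationSigma {T : Set ℕ} {t : ℕ} (ht : t ∈ T) :
    Measurable[perturbationSigma u v T] fun ω i => v t i ω :=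
  @measurable_pi_lambda _ _ _ (perturbationSigma u v T) _ _ fun i =>
    measurable_iff_comap_le.2 (comap_le_perturbationSigma (u := u) (v := v) (Sum.inr (t, i)) ht)

variable [MeasurableSpace Ω] {μ : Measure Ω}

theorem IsIIDUniformPerturbation.comap_le (h : IsIIDUniformPerturbation μ u v)
    (x : (ℕ × Fin m) ⊕ (ℕ × Fin n)) :
    MeasurableSpace.comap (Sum.elim (fun y => u y.1 y.2) (fun y => v y.1 y.2) x) inferInstance ≤
      ‹MeasurableSpace Ω› := by
  rw [← measurable_iff_comap_le]
  rcases x with x | x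
  · exact h.1 _ _
  · exact h.2.1 _ _

theorem IsIIDUniformPerturbation.perturbationSigma_le (h : IsIIDUniformPerturbation μ u v)
    (T : Set ℕ) : perturbationSigma u v T ≤ ‹MeasurableSpace Ω› :=
  iSup₂_le fun x _ => h.comap_le x

theorem IsIIDUniformPerturbation.indep (h : IsIIDUniformPerturbation μ u v) {S T : Set ℕ}
    (hST : Disjoint S T) : Indep (perturbationSigma u v S) (perturbationSigma u v T) μ :=
  indep_iSup_of_disjoint h.comap_le h.2.2.2.2.iIndep
    (Set.disjoint_left.2 fun _ hx hx' => Set.disjoint_left.1 hST hx hx')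

theorem IsIIDUniformPerturbation.iIndepFun_left (h : IsIIDUniformPerturbation μ u v) (t : ℕ) :
    iIndepFun (u t) μ :=
  h.2.2.2.2.precomp (g := fun i : Fin m => Sum.inl (t, i)) fun i j hij => by simpa using hij

theorem IsIIDUniformPerturbation.iIndepFun_right (h : IsIIDUniformPerturbation μ u v) (t : ℕ) :
    iIndepFun (v t) μ :=
  h.2.2.2.2.precomp (g := fun i : Fin n => Sum.inr (t, i)) fun i j hij => by simpa using hij

end Independence

theorem measurable_comp_of_measurableSet_fiber {Ω β γ : Type*} [MeasurableSpace Ω] [Countable β]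
    [MeasurableSpace γ] {f : Ω → β} (hf : ∀ x, MeasurableSet (f ⁻¹' {x})) (g : β → γ) :
    Measurable fun ω => g (f ω) := by
  let _ : MeasurableSpace β := ⊤
  exact (measurable_from_top (f := g)).comp (measurable_to_countable' hf)

/-! ### Expected decrease of the potential along the random run -/

section Trajectory

variable {n : ℕ}

/-- The sets of available strategies after `t` passes, as a function of the outcome `ω`. -/
noncomputable def sdoSets
    (getNash : Finset (Fin n) → Finset (Fin n) → (Fin n → ℝ) × (Fin n → ℝ))
    (argminSel argmaxSel : (Fin n → ℝ) → Fin n) (k l : Fin n)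
    {Ω : Type*} (u v : ℕ → Fin n → Ω → ℝ) (t : ℕ) (ω : Ω) : Finset (Fin n) × Finset (Fin n) :=
  ((sdoState (gameU n) getNash argminSel argmaxSel k l
      (fun t i => u t i ω) (fun t j => v t j ω) t).R,
    (sdoState (gameU n) getNash argminSel argmaxSel k l
      (fun t i => u t i ω) (fun t j => v t j ω) t).C)

variable {getNash : Finset (Fin n) → Finset (Fin n) → (Fin n → ℝ) × (Fin n → ℝ)}
  {argminSel argmaxSel : (Fin n → ℝ) → Fin n} {k l : Fin n}

/-- One pass of the loop on the sets of available strategies. -/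
noncomputable def sdoSetsStep
    (getNash : Finset (Fin n) → Finset (Fin n) → (Fin n → ℝ) × (Fin n → ℝ))
    (argminSel argmaxSel : (Fin n → ℝ) → Fin n) (x : Finset (Fin n) × Finset (Fin n))
    (a b : Fin n → ℝ) : Finset (Fin n) × Finset (Fin n) :=
  (insert (argminSel (gameU n *ᵥ (getNash x.1 x.2).2 - a)) x.1,
    insert (argmaxSel ((getNash x.1 x.2).1 ᵥ* gameU n + b)) x.2)

theorem sdoSets_succ {Ω : Type*} (u v : ℕ → Fin n → Ω → ℝ) (t : ℕ) (ω : Ω) :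
    sdoSets getNash argminSel argmaxSel k l u v (t + 1) ω =
      sdoSetsStep getNash argminSel argmaxSel
        (sdoSets getNash argminSel argmaxSel k l u v t ω) (fun i => u t i ω) (fun j => v t j ω) :=
  rfl

theorem sdoSets_nonempty {Ω : Type*} (u v : ℕ → Fin n → Ω → ℝ) (t : ℕ) (ω : Ω) :
    (sdoSets getNash argminSel argmaxSel k l u v t ω).1.Nonempty ∧
      (sdoSets getNash argminSel argmaxSel k l u v t ω).2.Nonempty :=
  sdoState_nonempty _ _

theorem measurableSet_sdoSetsStep (hmin : Measurable argminSel) (hmax : Measurable argmaxSel)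
    {Ω : Type*} {m : MeasurableSpace Ω} {a b : Ω → Fin n → ℝ} (ha : Measurable a)
    (hb : Measurable b) (x y : Finset (Fin n) × Finset (Fin n)) :
    MeasurableSet {ω | sdoSetsStep getNash argminSel argmaxSel x (a ω) (b ω) = y} := by
  have h1 : Measurable fun ω => argminSel (gameU n *ᵥ (getNash x.1 x.2).2 - a ω) :=
    hmin.comp (measurable_const.sub ha)
  have h2 : Measurable fun ω => argmaxSel ((getNash x.1 x.2).1 ᵥ* gameU n + b ω) :=
    hmax.comp (measurable_const.add hb)
  exact (h1.prodMk h2) (MeasurableSet.of_discrete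
    (s := {z : Fin n × Fin n | (insert z.1 x.1, insert z.2 x.2) = y}))

/-- The sets available before pass `t` depend only on earlier perturbations, and are therefore
independent of those of pass `t`. No measurability of `getNash` is needed, since its arguments range
over a finite type. -/
theorem measurableSet_sdoSets_eq (hmin : Measurable argminSel) (hmax : Measurable argmaxSel)
    {Ω : Type*} (u v : ℕ → Fin n → Ω → ℝ) (t : ℕ) (y : Finset (Fin n) × Finset (Fin n)) :
    MeasurableSet[perturbationSigma u v (Set.Iio t)]
      (sdoSets getNash argminSel argmaxSel k l u v t ⁻¹' {y}) := by
  induction t generalizing y with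
  | zero => exact MeasurableSet.const ((({k}, {l}) : Finset (Fin n) × Finset (Fin n)) = y)
  | succ t ih =>
    have : sdoSets getNash argminSel argmaxSel k l u v (t + 1) ⁻¹' {y} =
        ⋃ x, (sdoSets getNash argminSel argmaxSel k l u v t ⁻¹' {x}) ∩
          {ω | sdoSetsStep getNash argminSel argmaxSel x
            (fun i => u t i ω) (fun j => v t j ω) = y} := by
      ext ω
      simp [sdoSets_succ]
    rw [this]
    refine MeasurableSet.iUnion fun x => MeasurableSet.inter ?_ ?_
    · exact perturbationSigma_mono (Set.Iio_subset_Iio t.le_succ) _ (ih x)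
    · exact measurableSet_sdoSetsStep hmin hmax
        (measurable_left_perturbationSigma (Set.mem_Iio.2 t.lt_succ_self))
        (measurable_right_perturbationSigma (Set.mem_Iio.2 t.lt_succ_self)) x y

variable {Ω : Type*} [MeasurableSpace Ω] {μ : Measure Ω} {u v : ℕ → Fin n → Ω → ℝ}

/-- The event that after `t` passes not both players have their first strategy available. -/
def unfinished (getNash : Finset (Fin n) → Finset (Fin n) → (Fin n → ℝ) × (Fin n → ℝ))
    (argminSel argmaxSel : (Fin n → ℝ) → Fin n) (k l : Fin n)
    {Ω : Type*} (u v : ℕ → Fin n → Ω → ℝ) (t : ℕ) : Set Ω :=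
  {ω | ¬ (minIdx (sdoSets getNash argminSel argmaxSel k l u v t ω).1 = 0 ∧
    minIdx (sdoSets getNash argminSel argmaxSel k l u v t ω).2 = 0)}

theorem measurable_potential_sdoSets (hmin : Measurable argminSel) (hmax : Measurable argmaxSel)
    (h : IsIIDUniformPerturbation μ u v) (t : ℕ) :
    Measurable fun ω => potential (sdoSets getNash argminSel argmaxSel k l u v t ω) :=
  measurable_comp_of_measurableSet_fiber (fun x => h.perturbationSigma_le _ _
    (measurableSet_sdoSets_eq hmin hmax u v t x)) potential

theorem measurableSet_unfinished (hmin : Measurable argminSel) (hmax : Measurable argmaxSel)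
    (h : IsIIDUniformPerturbation μ u v) (t : ℕ) :
    MeasurableSet (unfinished getNash argminSel argmaxSel k l u v t) :=
  measurableSet_setOfPred.2 <| measurable_comp_of_measurableSet_fiber
    (fun x => h.perturbationSigma_le _ _ (measurableSet_sdoSets_eq hmin hmax u v t x))
    fun x => ¬ (minIdx x.1 = 0 ∧ minIdx x.2 = 0)

variable [IsProbabilityMeasure μ]

/-- The larger of the two minimal indices is the one that is halved. For fixed `R` and `C`, the
event involves only the perturbations of pass `t`; this makes it independent of the past. -/
theorem exists_potential_drop
    (hNash : ∀ R C : Finset (Fin n), R.Nonempty → C.Nonempty →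
      IsSubgameNash (gameU n) R C (getNash R C).1 (getNash R C).2)
    (hmin : IsArgminSelector argminSel) (hmax : IsArgmaxSelector argmaxSel)
    (h : IsIIDUniformPerturbation μ u v) (t : ℕ) {R C : Finset (Fin n)} (hR : R.Nonempty)
    (hC : C.Nonempty) (h0 : ¬ (minIdx R = 0 ∧ minIdx C = 0)) :
    ∃ B : Set Ω, MeasurableSet[perturbationSigma u v {t}] B ∧ halvingProb ≤ μ.real B ∧
      ∀ ω ∈ B, potential (sdoSetsStep getNash argminSel argmaxSel (R, C)
        (fun i => u t i ω) (fun j => v t j ω)) < potential (R, C) := by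
  obtain ⟨r, hrR, hr, hrmin⟩ := exists_eq_minIdx hR
  obtain ⟨c, hcC, hc, hcmin⟩ := exists_eq_minIdx hC
  have hN := hNash R C hR hC
  rcases le_or_gt r c with hrc | hcr
  · have hc1 : 1 ≤ (c : ℕ) := by
      have : (r : ℕ) ≤ c := hrc
      omega
    obtain ⟨τ, hτ⟩ := exists_halvingProb_le (h.2.1 t) (h.2.2.2.1 t) (h.iIndepFun_right t)
      (mem_stdSimplex_of_restrict hN.1 hN.2.2.1) c hc1
      (hN.vecMul_gameU_nonpos hrR hcC hcmin hrc)
    refine ⟨_, measurable_right_perturbationSigma (Set.mem_singleton t)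
      (measurableSet_thresholdSet _ _ _), hτ, fun ω hω => ?_⟩
    refine potential_insert_lt_of_right hR (hc ▸ hc1) ?_
    rw [← hc]
    exact le_of_mem_thresholdSet hω (hmax.2 _)
  · have hr1 : 1 ≤ (r : ℕ) := by
      have : (c : ℕ) < r := hcr
      omega
    obtain ⟨τ, hτ⟩ := exists_halvingProb_le (h.1 t) (h.2.2.1 t) (h.iIndepFun_left t)
      (mem_stdSimplex_of_restrict hN.2.1 hN.2.2.2.1) r hr1
      (hN.vecMul_gameU_nonpos' hrR hcC hrmin hcr.le)
    refine ⟨_, measurable_left_perturbationSigma (Set.mem_singleton t)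
      (measurableSet_thresholdSet _ _ _), hτ, fun ω hω => ?_⟩
    refine potential_insert_lt_of_left hC (hr ▸ hr1) ?_
    rw [← hr]
    -- As `Uq = -(qᵀU)`, a minimal entry of `Uq - u` is a maximal entry of `qᵀU + u`.
    refine le_of_mem_thresholdSet hω fun j => ?_
    have := hmin.2 (gameU n *ᵥ (getNash R C).2 - fun i => u t i ω) j
    simp only [gameU_mulVec, Pi.sub_apply, Pi.neg_apply] at this ⊢
    linarith

/-- Condition on the finitely many possible values of `(R, C)`. The event that lowers the potential
varies with this value, but is always independent of the event that the value is attained. -/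
theorem halvingProb_mul_measure_unfinished_le
    (hNash : ∀ R C : Finset (Fin n), R.Nonempty → C.Nonempty →
      IsSubgameNash (gameU n) R C (getNash R C).1 (getNash R C).2)
    (hmin : IsArgminSelector argminSel) (hmax : IsArgmaxSelector argmaxSel)
    (h : IsIIDUniformPerturbation μ u v) (t : ℕ) :
    ENNReal.ofReal halvingProb * μ (unfinished getNash argminSel argmaxSel k l u v t) ≤
      μ {ω | potential (sdoSets getNash argminSel argmaxSel k l u v (t + 1) ω) <
        potential (sdoSets getNash argminSel argmaxSel k l u v t ω)} := by
  classical
  set S := sdoSets getNash argminSel argmaxSel k l u v t with hS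
  have hfib' := measurableSet_sdoSets_eq (getNash := getNash) (k := k) (l := l) hmin.1 hmax.1 u v t
  have hfib : ∀ x, MeasurableSet (S ⁻¹' {x}) := fun x => h.perturbationSigma_le _ _ (hfib' x)
  set N : Finset (Finset (Fin n) × Finset (Fin n)) := Finset.univ.filter fun x =>
    (x.1.Nonempty ∧ x.2.Nonempty) ∧ ¬ (minIdx x.1 = 0 ∧ minIdx x.2 = 0) with hNdef
  have hN : ∀ x ∈ N, (x.1.Nonempty ∧ x.2.Nonempty) ∧ ¬ (minIdx x.1 = 0 ∧ minIdx x.2 = 0) :=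
    fun x hx => (Finset.mem_filter.1 hx).2
  have hunf : unfinished getNash argminSel argmaxSel k l u v t = S ⁻¹' N := by
    ext ω
    have : (S ω).1.Nonempty ∧ (S ω).2.Nonempty := sdoSets_nonempty u v t ω
    simp [unfinished, hNdef, this, ← hS]
  have hdrop : ∀ x : Finset (Fin n) × Finset (Fin n), ∃ B : Set Ω, x ∈ N →
      MeasurableSet[perturbationSigma u v {t}] B ∧ halvingProb ≤ μ.real B ∧
      ∀ ω ∈ B, potential (sdoSetsStep getNash argminSel argmaxSel x
        (fun i => u t i ω) (fun j => v t j ω)) < potential x := by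
    intro x
    by_cases hx : x ∈ N
    · obtain ⟨B, hB⟩ := exists_potential_drop hNash hmin hmax h t (hN x hx).1.1 (hN x hx).1.2
        (hN x hx).2
      exact ⟨B, fun _ => hB⟩
    · exact ⟨∅, fun hx' => absurd hx' hx⟩
  choose B hB using hdrop
  have hdisj : Disjoint (Set.Iio t) {t} := by simp
  have hind := (h.indep hdisj)
  rw [Indep_iff] at hind
  calc ENNReal.ofReal halvingProb * μ (unfinished getNash argminSel argmaxSel k l u v t)
      = ∑ x ∈ N, μ (S ⁻¹' {x}) * ENNReal.ofReal halvingProb := by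
        rw [hunf, ← sum_measure_preimage_singleton N fun x _ => hfib x, mul_comm, Finset.sum_mul]
    _ ≤ ∑ x ∈ N, μ (S ⁻¹' {x} ∩ B x) := by
        refine Finset.sum_le_sum fun x hx => ?_
        rw [hind _ _ (hfib' x) (hB x hx).1]
        gcongr
        exact ENNReal.ofReal_le_of_le_toReal (hB x hx).2.1
    _ = μ (⋃ x ∈ N, S ⁻¹' {x} ∩ B x) := by
        refine (measure_biUnion_finset ?_ fun x hx =>
          (hfib x).inter (h.perturbationSigma_le _ _ (hB x hx).1)).symm
        intro x _ y _ hxy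
        refine Set.disjoint_left.2 fun ω hx hy => hxy ?_
        exact hx.1.symm.trans hy.1
    _ ≤ _ := by
        refine measure_mono (Set.iUnion₂_subset fun x hx ω hω => ?_)
        have h1 : S ω = x := hω.1
        have h2 := (hB x hx).2.2 ω hω.2
        simp only [Set.mem_ofPred_eq, sdoSets_succ]
        rw [← hS, h1]
        exact h2

/-- The potential is integer-valued and never increases, so its expectation falls by at least the
probability of a strict drop. Summing over `t` telescopes to a bound by the initial potential. -/
theorem halvingProb_mul_measure_unfinished_add_lintegral_le
    (hNash : ∀ R C : Finset (Fin n), R.Nonempty → C.Nonempty →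
      IsSubgameNash (gameU n) R C (getNash R C).1 (getNash R C).2)
    (hmin : IsArgminSelector argminSel) (hmax : IsArgmaxSelector argmaxSel)
    (h : IsIIDUniformPerturbation μ u v) (t : ℕ) :
    ENNReal.ofReal halvingProb * μ (unfinished getNash argminSel argmaxSel k l u v t) +
      ∫⁻ ω, (potential (sdoSets getNash argminSel argmaxSel k l u v (t + 1) ω) : ℝ≥0∞) ∂μ ≤
      ∫⁻ ω, (potential (sdoSets getNash argminSel argmaxSel k l u v t ω) : ℝ≥0∞) ∂μ := by
  have hm := fun t => measurable_potential_sdoSets (getNash := getNash) (k := k) (l := l)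
    hmin.1 hmax.1 h t
  set D := {ω | potential (sdoSets getNash argminSel argmaxSel k l u v (t + 1) ω) <
        potential (sdoSets getNash argminSel argmaxSel k l u v t ω)} with hD
  have hDm : MeasurableSet D := measurableSet_lt (hm _) (hm _)
  calc _ ≤ μ D + ∫⁻ ω, (potential (sdoSets getNash argminSel argmaxSel k l u v (t + 1) ω) : ℝ≥0∞)
          ∂μ := by
        gcongr
        exact halvingProb_mul_measure_unfinished_le hNash hmin hmax h t
    _ = ∫⁻ ω, (D.indicator 1 ω +
          (potential (sdoSets getNash argminSel argmaxSel k l u v (t + 1) ω) : ℝ≥0∞)) ∂μ := by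
        rw [lintegral_add_left (measurable_one.indicator hDm), lintegral_indicator_one hDm]
    _ ≤ _ := by
        refine lintegral_mono fun ω => ?_
        by_cases hω : ω ∈ D
        · rw [Set.indicator_of_mem hω, Pi.one_apply, add_comm]
          have : potential (sdoSets getNash argminSel argmaxSel k l u v (t + 1) ω) <
            potential (sdoSets getNash argminSel argmaxSel k l u v t ω) := hω
          exact (Nat.cast_succ _).symm.trans_le (Nat.mono_cast (Nat.succ_le_of_lt this))
        · rw [Set.indicator_of_notMem hω, zero_add]
          have hne := sdoSets_nonempty (getNash := getNash) (argminSel := argminSel)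
            (argmaxSel := argmaxSel) (k := k) (l := l) u v t ω
          exact Nat.mono_cast (potential_insert_le hne.1 hne.2 _ _)

theorem halvingProb_mul_tsum_measure_unfinished_le
    (hNash : ∀ R C : Finset (Fin n), R.Nonempty → C.Nonempty →
      IsSubgameNash (gameU n) R C (getNash R C).1 (getNash R C).2)
    (hmin : IsArgminSelector argminSel) (hmax : IsArgmaxSelector argmaxSel)
    (h : IsIIDUniformPerturbation μ u v) :
    ENNReal.ofReal halvingProb *
      ∑' t, μ (unfinished getNash argminSel argmaxSel k l u v t) ≤
      (potential (({k} : Finset (Fin n)), ({l} : Finset (Fin n))) : ℝ≥0∞) := by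
  have hpart : ∀ N : ℕ, (∑ t ∈ Finset.range N, ENNReal.ofReal halvingProb *
      μ (unfinished getNash argminSel argmaxSel k l u v t)) +
      ∫⁻ ω, (potential (sdoSets getNash argminSel argmaxSel k l u v N ω) : ℝ≥0∞) ∂μ ≤
      (potential (({k} : Finset (Fin n)), ({l} : Finset (Fin n))) : ℝ≥0∞) := by
    intro N
    induction N with
    | zero => simp [sdoSets, sdoState, sdoInit]
    | succ N ih =>
      rw [Finset.sum_range_succ, add_assoc]
      refine le_trans ?_ ih
      gcongr
      exact halvingProb_mul_measure_unfinished_add_lintegral_le hNash hmin hmax h N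
  rw [← ENNReal.tsum_mul_left, ENNReal.tsum_eq_iSup_nat]
  exact iSup_le fun N => le_self_add.trans (hpart N)

/-- The extra `1` is the pass that solves the first subgame with index `0` available to both
players. On runs that never reach such a subgame the right side is infinite. -/
theorem sdoIterations_le_one_add_tsum
    (hNash : ∀ R C : Finset (Fin n), R.Nonempty → C.Nonempty →
      IsSubgameNash (gameU n) R C (getNash R C).1 (getNash R C).2)
    {ε : ℝ} (hε : 0 ≤ ε) {Ω : Type*} {u v : ℕ → Fin n → Ω → ℝ} (ω : Ω) :
    ((sdoIterations (gameU n) ε getNash argminSel argmaxSel k l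
      (fun t i => u t i ω) (fun t j => v t j ω) : ℕ∞) : ℝ≥0∞) ≤
      1 + ∑' t, (unfinished getNash argminSel argmaxSel k l u v t).indicator 1 ω := by
  classical
  by_cases hex : ∃ t, ω ∉ unfinished getNash argminSel argmaxSel k l u v t
  · set T := Nat.find hex
    have hT : ω ∉ unfinished getNash argminSel argmaxSel k l u v T := Nat.find_spec hex
    obtain ⟨h1, h2⟩ := not_not.1 hT
    have hne := sdoSets_nonempty (getNash := getNash) (argminSel := argminSel)
      (argmaxSel := argmaxSel) (k := k) (l := l) u v T ω
    have h_stops := sdoIterations_le (sdoStops_gameU_succ (argminSel := argminSel)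
      (argmaxSel := argmaxSel) (k := k) (l := l) (u := fun t i => u t i ω)
      (v := fun t j => v t j ω) hNash hε k.pos
      (zero_mem_of_minIdx_eq_zero hne.1 k.pos h1) (zero_mem_of_minIdx_eq_zero hne.2 k.pos h2))
    calc _ ≤ (((T + 1 : ℕ) : ℕ∞) : ℝ≥0∞) := ENat.toENNReal_le.2 h_stops
      _ = 1 + ∑ t ∈ Finset.range T,
          (unfinished getNash argminSel argmaxSel k l u v t).indicator 1 ω := by
        rw [Finset.sum_congr rfl fun t ht => Set.indicator_of_mem
          (not_not.1 (Nat.find_min hex (Finset.mem_range.1 ht))) 1]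
        simp [T, add_comm]
      _ ≤ _ := by gcongr; exact ENNReal.sum_le_tsum _
  · push Not at hex
    simp_rw [Set.indicator_of_mem (hex _), Pi.one_apply]
    rw [ENNReal.tsum_const_eq_top_of_ne_zero one_ne_zero, add_top]
    exact le_top

theorem lintegral_one_add_tsum_unfinished_le
    (hNash : ∀ R C : Finset (Fin n), R.Nonempty → C.Nonempty →
      IsSubgameNash (gameU n) R C (getNash R C).1 (getNash R C).2)
    (hmin : IsArgminSelector argminSel) (hmax : IsArgmaxSelector argmaxSel)
    (h : IsIIDUniformPerturbation μ u v) :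
    ∫⁻ ω, (1 + ∑' t, (unfinished getNash argminSel argmaxSel k l u v t).indicator 1 ω) ∂μ ≤
      ENNReal.ofReal (1 + (potential (({k} : Finset (Fin n)), ({l} : Finset (Fin n))) : ℝ) /
        halvingProb) := by
  have hm := fun t => measurableSet_unfinished (getNash := getNash) (k := k) (l := l)
    hmin.1 hmax.1 h t
  have hδ := halvingProb_pos
  rw [lintegral_add_left measurable_const, lintegral_const, measure_univ, mul_one,
    lintegral_tsum fun t => (measurable_one.indicator (hm t)).aemeasurable,
    ENNReal.ofReal_add zero_le_one (by positivity), ENNReal.ofReal_one,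
    ENNReal.ofReal_div_of_pos hδ, ENNReal.ofReal_natCast]
  simp_rw [lintegral_indicator_one (hm _)]
  gcongr
  rw [ENNReal.le_div_iff_mul_le (Or.inl (by simpa using hδ)) (Or.inl ENNReal.ofReal_ne_top),
    mul_comm]
  exact halvingProb_mul_tsum_measure_unfinished_le hNash hmin hmax h

/-- Needed for `n = 1`, where the claimed bound `K * log n` is zero. -/
theorem sdoIterations_eq_zero_of_subsingleton [Subsingleton (Fin n)]
    {ε : ℝ} (hε : 0 ≤ ε) (u v : ℕ → Fin n → ℝ) :
    sdoIterations (gameU n) ε getNash argminSel argmaxSel k l u v = 0 := by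
  refine le_antisymm (sdoIterations_le (t := 0) ?_) bot_le
  have h1 := brValCol_single_zero k.pos
  have h2 := brValRow_single_zero k.pos
  have hk : k = ⟨0, k.pos⟩ := Subsingleton.elim _ _
  have hl : l = ⟨0, k.pos⟩ := Subsingleton.elim _ _
  simp only [sdoStops, sdoState, sdoInit]
  rw [hk, hl]
  linarith

end Trajectory

end MatrixGame

/-! ### The main theorem -/

theorem mainTheorem3 :
    ∃ K : ℝ, ∀ (n : ℕ) (k l : Fin n) (ε : ℝ), 0 ≤ ε → ε < 1 →
      ∀ (getNash : Finset (Fin n) → Finset (Fin n) → (Fin n → ℝ) × (Fin n → ℝ))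
        (argminSel argmaxSel : (Fin n → ℝ) → Fin n),
        (∀ R C : Finset (Fin n), R.Nonempty → C.Nonempty →
          MatrixGame.IsSubgameNash (MatrixGame.gameU n) R C (getNash R C).1 (getNash R C).2) →
        MatrixGame.IsArgminSelector argminSel → MatrixGame.IsArgmaxSelector argmaxSel →
      ∀ {Ω : Type*} [MeasurableSpace Ω] (μ : Measure Ω) [IsProbabilityMeasure μ]
        (u v : ℕ → Fin n → Ω → ℝ), MatrixGame.IsIIDUniformPerturbation μ u v →
        (∫⁻ ω, ((MatrixGame.sdoIterations (MatrixGame.gameU n) ε getNash argminSel argmaxSel k l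
              (fun t i => u t i ω) (fun t j => v t j ω) : ℕ∞) : ℝ≥0∞) ∂μ
            ≤ ENNReal.ofReal (K * Real.log n)) ∧
        (∀ᵐ ω ∂μ, ∃ T : ℕ,
          MatrixGame.sdoIterations (MatrixGame.gameU n) ε getNash argminSel argmaxSel k l
            (fun t i => u t i ω) (fun t j => v t j ω) = (T : ℕ∞) ∧
          MatrixGame.IsNash (MatrixGame.gameU n)
            (MatrixGame.sdoState (MatrixGame.gameU n) getNash argminSel argmaxSel k l
              (fun t i => u t i ω) (fun t j => v t j ω) T).p
            (MatrixGame.sdoState (MatrixGame.gameU n) getNash argminSel argmaxSel k l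
              (fun t i => u t i ω) (fun t j => v t j ω) T).q) ∧
        (∀ p q : Fin n → ℝ, MatrixGame.IsNash (MatrixGame.gameU n) p q ↔
          p = Pi.single ⟨0, k.pos⟩ 1 ∧ q = Pi.single ⟨0, k.pos⟩ 1) := by
  refine ⟨(1 + 4 / MatrixGame.halvingProb) / Real.log 2, ?_⟩
  intro n k l ε hε0 hε1 getNash argminSel argmaxSel hNash hmin hmax Ω _ μ _ u v h
  have hδ := MatrixGame.halvingProb_pos
  have hlog2 : 0 < Real.log 2 := Real.log_pos one_lt_two
  have hle := MatrixGame.lintegral_one_add_tsum_unfinished_le (k := k) (l := l)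
    hNash hmin hmax h
  have hpt := fun ω => MatrixGame.sdoIterations_le_one_add_tsum (argminSel := argminSel)
    (argmaxSel := argmaxSel) (k := k) (l := l) (u := u) (v := v) hNash hε0 ω
  refine ⟨?_, ?_, MatrixGame.isNash_gameU_iff k.pos⟩
  · rcases Nat.lt_or_ge n 2 with hn | hn
    · have : Subsingleton (Fin n) := Fin.subsingleton_iff_le_one.2 (by omega)
      simp [MatrixGame.sdoIterations_eq_zero_of_subsingleton hε0]
    · refine (lintegral_mono hpt).trans (hle.trans (ENNReal.ofReal_le_ofReal ?_))
      -- For `n ≥ 2` the additive `1` is absorbed into the logarithm, which explains the form of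
      -- `K`.
      have h1 : 1 ≤ Real.log n / Real.log 2 := by
        rw [le_div_iff₀ hlog2, one_mul]
        exact Real.log_le_log two_pos (by exact_mod_cast hn)
      calc _ ≤ Real.log n / Real.log 2 +
            4 * (Real.log n / Real.log 2) / MatrixGame.halvingProb := by
            gcongr
            exact MatrixGame.potential_singleton_le k l hn
        _ = _ := by ring
  -- Almost sure termination is read off the measurable majorant, whose integral is finite;
  -- measurability of the iteration count itself is not needed.
  · have hmeas : Measurable fun ω => 1 + ∑' t, (MatrixGame.unfinished getNash argminSel argmaxSel
        k l u v t).indicator (1 : Ω → ℝ≥0∞) ω :=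
      (Measurable.tsum fun t => measurable_one.indicator
        (MatrixGame.measurableSet_unfinished hmin.1 hmax.1 h t)).const_add 1
    filter_upwards [ae_lt_top hmeas (ne_top_of_le_ne_top ENNReal.ofReal_ne_top hle)] with ω hω
    obtain ⟨T, hT, h_stops⟩ := MatrixGame.exists_sdoStops_of_sdoIterations_ne_top
      (M := MatrixGame.gameU n) (ε := ε) (getNash := getNash) (argminSel := argminSel)
      (argmaxSel := argmaxSel) (k := k) (l := l) (u := fun t i => u t i ω)
      (v := fun t j => v t j ω) (by
        intro htop
        have := (hpt ω).trans_lt hω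
        rw [htop] at this
        simp at this)
    exact ⟨T, hT, MatrixGame.isNash_of_sdoStops hNash hε1 h_stops⟩
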